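/- Let $2<\tau<3$ and let $f:[0,\infty)\to\mathbb R$ be continuous, nonnegative and nondecreasing with $f(x)/x\to1$ as $x\downarrow0$ and $f(x)\to1$ as $x\to\infty$. Put $\mu=\frac{\tau-1}{\tau-2}$ and $\gamma_n=\sqrt{n\mu}$. Consider the rank-1 inhomogeneous random graph on $n$ vertices: the vertices carry i.i.d. weights $h_1,\dots,h_n$ with density $\rho(h)=(\tau-1)h^{-\tau}$, $h\ge1$, and, given the weights, any two distinct vertices $i,j$ are joined by an edge with probability $f(h_ih_j/\gamma_n^2)$, independently over all pairs. Let $C_k(n)$ be the average (expected) number of cycles of length $k$ in this graph, where a cycle is counted once, irrespective of starting point and orientation. Then for every fixed even $k\ge4$, as $n\to\infty$, $$C_k(n)\sim\bigl(\gamma_n^{k(1-\tau)}\log\gamma_n\bigr)(\tau-1)^k\,\frac1k\binom nk k!\int_{-\infty}^\infty|J(v)|^k\,dv,$$ that is, the quotient of the two sides tends to $1$. Here $$J(v)=\int_0^\infty x^{-2\pi iv-\frac12(\tau+1)}f(x)\,dx=\int_{-\infty}^\infty e^{-2\pi iuv}j(u)\,du,\qquad v\in\mathbb R,$$ is the Fourier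 transform of $j(u)=e^{-\frac12(\tau-1)u}f(e^u)$; the integral defining $J(v)$ converges absolutely for every $v$, and $\int_{-\infty}^\infty|J(v)|^k\,dv<\infty$. -/

import Mathlib

open MeasureTheory ProbabilityTheory Filter Topology FourierTransform

noncomputable section

namespace RankOneGraph

/-- The class of connection functions: `f` is continuous, nonnegative and nondecreasing on
`[0, ∞)`, with `f x / x → 1` as `x ↓ 0` and `f x → 1` as `x → ∞`.
(The values of `f` at negative arguments play no role.) -/
structure IsConnectionFunction (f : ℝ → ℝ) : Prop where
  continuousOn : ContinuousOn f (Set.Ici 0)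
  nonneg : ∀ x, 0 ≤ x → 0 ≤ f x
  monotoneOn : MonotoneOn f (Set.Ici 0)
  tendsto_div_zero : Tendsto (fun x => f x / x) (𝓝[>] 0) (𝓝 1)
  tendsto_atTop : Tendsto f atTop (𝓝 1)

/-- `γ_n = √(n μ)`, where `μ = (τ - 1) / (τ - 2)` is the mean of the weight density
`(τ - 1) h ^ (-τ)`, `h ≥ 1`. -/
def gam (τ : ℝ) (n : ℕ) : ℝ := Real.sqrt (n * ((τ - 1) / (τ - 2)))

/-- The sample space of the graph on `n` vertices: a weight for every vertex, and a uniform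
variable for every unordered pair of vertices (those on the diagonal are not used). -/
abbrev Sample (n : ℕ) : Type := (Fin n → ℝ) × (Sym2 (Fin n) → unitInterval)

/-- The law of the sample: the weights are i.i.d. with density `(τ - 1) h ^ (-τ)` on `[1, ∞)`
(the Pareto distribution of scale `1` and rate `τ - 1`), the other variables are i.i.d. uniform
on `[0, 1]` and independent of the weights. -/
def sampleLaw (τ : ℝ) (n : ℕ) : Measure (Sample n) :=
  (Measure.pi fun _ : Fin n => paretoMeasure 1 (τ - 1)).prod
    (Measure.pi fun _ : Sym2 (Fin n) => (volume : Measure unitInterval))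

/-- The rank-1 inhomogeneous random graph: given the weights, distinct vertices `i` and `j` are
joined with probability `f (h_i h_j / γ_n ^ 2)`, independently over unordered pairs. -/
def randomGraph (τ : ℝ) (f : ℝ → ℝ) (n : ℕ) (ω : Sample n) : SimpleGraph (Fin n) where
  Adj i j := i ≠ j ∧ (ω.2 s(i, j) : ℝ) < f (ω.1 i * ω.1 j / gam τ n ^ 2)
  symm := ⟨fun i j h => ⟨h.1.symm, by rw [Sym2.eq_swap, mul_comm]; exact h.2⟩⟩
  loopless := ⟨fun _ h => h.1 rfl⟩

/-- The number of `k`-cycles in the random graph, that is, of subgraphs isomorphic to the cycle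
on `k` vertices (so a cycle is counted once, without starting point or orientation). -/
def cycleCount (τ : ℝ) (f : ℝ → ℝ) (k n : ℕ) (ω : Sample n) : ℝ :=
  ((randomGraph τ f n ω).copyCount (SimpleGraph.cycleGraph k) : ℝ)

/-- `C_k(n)`: the average number of `k`-cycles in the random graph on `n` vertices. -/
def avgCycles (τ : ℝ) (f : ℝ → ℝ) (k n : ℕ) : ℝ :=
  ∫ ω, cycleCount τ f k n ω ∂(sampleLaw τ n)

/-- The integrand `x ^ (-2πiv - (τ + 1) / 2) f x` of `J v`. -/
def integrandJ (τ : ℝ) (f : ℝ → ℝ) (v x : ℝ) : ℂ :=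
  (x : ℂ) ^ (-2 * (Real.pi : ℂ) * Complex.I * (v : ℂ) - ((τ : ℂ) + 1) / 2) * (f x : ℂ)

/-- `J v = ∫_0^∞ x ^ (-2πiv - (τ + 1) / 2) f x dx`. -/
def J (τ : ℝ) (f : ℝ → ℝ) (v : ℝ) : ℂ := ∫ x in Set.Ioi (0 : ℝ), integrandJ τ f v x

/-- `j u = exp (-(τ - 1) u / 2) f (exp u)`. -/
def jfun (τ : ℝ) (f : ℝ → ℝ) (u : ℝ) : ℂ :=
  ((Real.exp (-(τ - 1) * u / 2) * f (Real.exp u) : ℝ) : ℂ)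

end RankOneGraph

end

/-! A `k`-cycle is an embedding of `k` vertices modulo `2k` automorphisms, so `C_k(n)` is `n.choose
k * k! / (2k)` times the probability that one fixed closed walk is present. Given the weights its
edges are independent. Writing `h_i = γ exp u_i` and sharing each density factor `exp (-(τ - 1)
u_i)` equally between the two edges at `i` turns this probability into `((τ - 1) γ ^ (1 - τ)) ^ k`
times the integral of `∏ j (u_i + u_{i+1})` over all `u_i ≥ -L`, where `L = log γ` (`cycleProb_eq`).

For even `k` the integrand is invariant under `u_i ↦ u_i + (-1)^i t`. On each orbit the constraint
leaves an interval of length `2L` up to an error not depending on `L`, so the integral is asymptotic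
to `2L` times that over the slice `u_0 = 0` (`tendsto_cycleIntegral_div`). This produces the
logarithm, and the `2` cancels the one in `2k`.

The slice integral is the value at `0` of the function obtained from `j` by `k - 1` applications of
the operator with kernel `j (x + y)`. Two applications multiply the Fourier transform by `J v * J
(-v) = |J v|²`, so that function has transform `|J|^k`, and inversion at `0` yields the constant
(`IsNiceKernel.integral_norm_fourier_pow`). Exponential decay of `j` at both ends, which at `-∞`
rests on `τ < 3`, justifies the limits. -/

open scoped ENNReal

/-! ### Labelled copies and automorphisms of the cycle -/

namespace SimpleGraph

variable {V W : Type*}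

lemma Copy.exists_iso_of_toSubgraph_eq {H : SimpleGraph W} {G : SimpleGraph V} (f : Copy H G)
    {S : G.Subgraph} (hS : f.toSubgraph = S) : ∃ e : H ≃g S.coe, ∀ x, (e x : V) = f x := by
  subst hS
  exact ⟨f.isoToSubgraph, fun _ => rfl⟩

lemma Copy.toSubgraph_comp_iso {H : SimpleGraph W} {G : SimpleGraph V} (f : Copy H G)
    (φ : H ≃g H) : (f.comp φ.toCopy).toSubgraph = f.toSubgraph := by
  ext a b
  · simp only [Copy.toSubgraph, Subgraph.map_verts, Subgraph.verts_top, Set.image_univ,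
      Set.mem_range]
    exact ⟨fun ⟨y, hy⟩ => ⟨φ y, hy⟩, fun ⟨y, hy⟩ => ⟨φ.symm y, by
      rw [← hy]; exact congrArg f (φ.apply_symm_apply y)⟩⟩
  · simp only [Copy.toSubgraph, Subgraph.map_adj, Relation.Map, Subgraph.top_adj]
    constructor
    · rintro ⟨x, y, hxy, hx, hy⟩
      exact ⟨φ x, φ y, φ.map_adj_iff.2 hxy, hx, hy⟩
    · rintro ⟨x, y, hxy, hx, hy⟩
      refine ⟨φ.symm x, φ.symm y, φ.symm.map_adj_iff.2 hxy, ?_, ?_⟩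
      · rw [← hx]; exact congrArg f (φ.apply_symm_apply x)
      · rw [← hy]; exact congrArg f (φ.apply_symm_apply y)

/-- The labelled copies of a graph with a given image are a torsor under the automorphisms. -/
lemma card_copy_eq_copyCount_mul_card_iso [Fintype V] [Fintype W] (G : SimpleGraph V)
    (H : SimpleGraph W) : Nat.card (Copy H G) = G.copyCount H * Nat.card (H ≃g H) := by
  classical
  have : Fintype (H ≃g H) := have := DFunLike.finite (H ≃g H); Fintype.ofFinite _
  rw [Nat.card_eq_fintype_card, copyCount_eq_card_image_copyToSubgraph, ← Finset.card_univ,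
    Finset.card_eq_sum_card_image Copy.toSubgraph, Finset.sum_const_nat]
  intro S hS
  obtain ⟨f₀, -, hf₀⟩ := Finset.mem_image.1 hS
  obtain ⟨e₀, he₀⟩ := f₀.exists_iso_of_toSubgraph_eq hf₀
  rw [Nat.card_eq_fintype_card, ← Finset.card_univ]
  symm
  refine Finset.card_bij (fun φ _ => f₀.comp φ.toCopy) ?_ ?_ ?_
  · intro φ _
    simp only [Finset.mem_filter_univ]
    rw [Copy.toSubgraph_comp_iso, hf₀]
  · intro φ _ ψ _ h
    exact RelIso.ext fun x => f₀.injective (DFunLike.congr_fun h x)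
  · intro f hf
    obtain ⟨e, he⟩ := f.exists_iso_of_toSubgraph_eq (Finset.mem_filter.1 hf).2
    refine ⟨e.trans e₀.symm, Finset.mem_univ _, DFunLike.ext _ _ fun x => ?_⟩
    change f₀ (e₀.symm (e x)) = f x
    rw [← he₀, ← he]
    exact congrArg Subtype.val (e₀.apply_symm_apply (e x))

/-- An automorphism is forced step by step: the image of `x + 2` is a neighbour of the image of `x +
1` other than the image of `x`, and a vertex has only two neighbours. -/
lemma cycleGraph_iso_ext {n : ℕ} {φ ψ : cycleGraph (n + 3) ≃g cycleGraph (n + 3)}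
    (h0 : φ 0 = ψ 0) (h1 : φ 1 = ψ 1) : φ = ψ := by
  have key : ∀ i : Fin (n + 2), φ i.castSucc = ψ i.castSucc ∧ φ i.succ = ψ i.succ := by
    intro i
    induction i using Fin.induction with
    | zero => exact ⟨h0, h1⟩
    | succ i ih =>
      obtain ⟨ha, hb⟩ := ih
      refine ⟨by simpa using hb, ?_⟩
      have e1 : i.castSucc.succ = i.castSucc.castSucc + 1 := (Fin.coeSucc_eq_succ).symm
      have e2 : i.succ.succ = i.castSucc.castSucc + 1 + 1 := by
        rw [← e1]; exact (Fin.coeSucc_eq_succ (a := i.succ)).symm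
      rw [e1] at hb
      rw [e2]
      generalize (i.castSucc.castSucc : Fin (n + 3)) = x at *
      have two : x + 1 + 1 ≠ x := by
        intro h
        exact absurd (add_eq_left.1 ((add_assoc x 1 1).symm.trans h)) (ne_of_beq_false rfl)
      have hne : ∀ χ : cycleGraph (n + 3) ≃g cycleGraph (n + 3), χ (x + 1 + 1) ≠ χ x :=
        fun χ h => two (χ.injective h)
      have hadj : ∀ (χ : cycleGraph (n + 3) ≃g cycleGraph (n + 3)) (y : Fin (n + 3)),
          χ y - χ (y + 1) = 1 ∨ χ (y + 1) - χ y = 1 := by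
        intro χ y
        exact cycleGraph_adj.1 (χ.map_adj_iff.2 (cycleGraph_adj.2 (Or.inr (by abel))))
      have a1 := hadj φ x
      have a2 := hadj φ (x + 1)
      have a3 := hadj ψ (x + 1)
      have n1 := hne φ
      have n2 := hne ψ
      rw [← ha, ← hb] at *
      simp only [sub_eq_iff_eq_add] at a1 a2 a3
      generalize φ (x + 1 + 1) = p at *
      generalize ψ (x + 1 + 1) = q at *
      generalize φ (x + 1) = r at *
      generalize φ x = s at *
      rcases a2 with h2 | h2 <;> rcases a3 with h3 | h3
      · exact add_left_cancel (h2.symm.trans h3)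
      · rcases a1 with a1 | a1
        · exact absurd (h3.trans a1.symm) n2
        · exact absurd (add_left_cancel (h2.symm.trans a1)) n1
      · rcases a1 with a1 | a1
        · exact absurd (h2.trans a1.symm) n1
        · exact absurd (add_left_cancel (h3.symm.trans a1)) n2
      · exact h2.trans h3.symm
  refine RelIso.ext fun x => ?_
  induction x using Fin.lastCases with
  | last => exact (key (Fin.last _)).2
  | cast i => exact (key i).1

/-- The rotations and reflections of a cycle. -/
def cycleGraphDihedral (n : ℕ) (p : Fin (n + 3) × Bool) :
    cycleGraph (n + 3) ≃g cycleGraph (n + 3) where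
  toEquiv := if p.2 then Equiv.addLeft p.1 else Equiv.subLeft p.1
  map_rel_iff' := by
    intro a b
    rw [cycleGraph_adj, cycleGraph_adj]
    split_ifs
    · simp
    · simp [or_comm]

/-- The image of `1` is one of the two neighbours of the image of `0`, and this choice selects a
rotation or a reflection. -/
lemma card_cycleGraph_iso (n : ℕ) :
    Nat.card (cycleGraph (n + 3) ≃g cycleGraph (n + 3)) = 2 * (n + 3) := by
  have hbij : Function.Bijective (cycleGraphDihedral n) := by
    have h1 : ∀ a, cycleGraphDihedral n (a, true) 0 = a := fun a => add_zero a
    have h2 : ∀ a, cycleGraphDihedral n (a, false) 0 = a := fun a => sub_zero a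
    have h3 : ∀ a, cycleGraphDihedral n (a, true) 1 = a + 1 := fun a => rfl
    have h4 : ∀ a, cycleGraphDihedral n (a, false) 1 = a - 1 := fun a => rfl
    have hne : ∀ a : Fin (n + 3), a + 1 ≠ a - 1 := by
      intro a h
      rw [eq_sub_iff_add_eq, add_assoc, add_eq_left] at h
      exact absurd h (ne_of_beq_false rfl)
    constructor
    · rintro ⟨a, b⟩ ⟨a', b'⟩ h
      have e0 := DFunLike.congr_fun h 0
      have e1 := DFunLike.congr_fun h 1
      cases b <;> cases b' <;> simp only [h1, h2, h3, h4] at e0 e1 <;> subst e0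
      · rfl
      · exact absurd e1.symm (hne _)
      · exact absurd e1 (hne _)
      · rfl
    · intro φ
      have hadj : φ 0 - φ 1 = 1 ∨ φ 1 - φ 0 = 1 :=
        cycleGraph_adj.1 (φ.map_adj_iff.2 (cycleGraph_adj.2 (Or.inr (by abel))))
      rcases hadj with h | h
      · refine ⟨(φ 0, false), cycleGraph_iso_ext (h2 _) ?_⟩
        rw [h4]; exact (eq_sub_of_add_eq' (sub_eq_iff_eq_add.1 h).symm).symm
      · refine ⟨(φ 0, true), cycleGraph_iso_ext (h1 _) ?_⟩
        rw [h3]; exact (sub_eq_iff_eq_add'.1 h).symm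
  rw [← Nat.card_congr (Equiv.ofBijective _ hbij)]
  simp [mul_comm]

end SimpleGraph

/-! ### Independence and the expected number of cycles -/

/-- Restricting independent identically distributed variables along an injection of the index
sets yields independent variables with the same law. -/
lemma MeasureTheory.measurePreserving_comp_injective {ι κ X : Type*} [Fintype ι] [Fintype κ]
    [MeasurableSpace X] (μ : Measure X) [IsProbabilityMeasure μ] {e : ι → κ}
    (he : Function.Injective e) :
    MeasurePreserving (fun ω : κ → X => ω ∘ e) (Measure.pi fun _ => μ)
      (Measure.pi fun _ => μ) := by
  classical
  have hm : Measurable (fun ω : κ → X => ω ∘ e) := by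
    rw [measurable_pi_iff]
    exact fun i => measurable_pi_apply _
  refine ⟨hm, (Measure.pi_eq fun s hs => ?_).symm⟩
  rw [Measure.map_apply hm (MeasurableSet.univ_pi hs)]
  -- Coordinates outside the range of `e` are unconstrained and contribute factors of mass one.
  have : (fun ω : κ → X => ω ∘ e) ⁻¹' (Set.pi Set.univ s) =
      Set.pi Set.univ (Function.extend e s fun _ => Set.univ) := by
    ext ω
    simp only [Set.mem_preimage, Set.mem_pi, Set.mem_univ, true_implies, Function.comp_apply]
    constructor
    · intro h x
      by_cases hx : ∃ i, e i = x
      · obtain ⟨i, rfl⟩ := hx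
        rw [he.extend_apply]
        exact h i
      · rw [Function.extend_apply' _ _ _ hx]
        trivial
    · intro h i
      have := h (e i)
      rwa [he.extend_apply] at this
  rw [this, Measure.pi_pi]
  symm
  refine Finset.prod_of_injOn e he.injOn (fun _ _ => Finset.mem_coe.2 (Finset.mem_univ _))
    (fun x _ hx => ?_) (fun i _ => by rw [he.extend_apply])
  rw [Function.extend_apply' _ _ _ (fun ⟨i, hi⟩ => hx ⟨i, Finset.mem_coe.2 (Finset.mem_univ _), hi⟩)]
  exact measure_univ

namespace RankOneGraph

lemma volume_unitInterval_lt {p : ℝ} (h0 : 0 ≤ p) (h1 : p ≤ 1) :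
    volume {u : unitInterval | (u : ℝ) < p} = ENNReal.ofReal p :=
  unitInterval.volume_Iio (⟨p, h0, h1⟩ : unitInterval)

/-- The probability that the closed walk through `m + 1` given distinct vertices is present. -/
noncomputable def cycleProb (τ : ℝ) (g : ℝ → ℝ) (m : ℕ) (c : ℝ) : ℝ≥0∞ :=
  ∫⁻ h : Fin (m + 1) → ℝ, ∏ i, ENNReal.ofReal (g (h i * h (i + 1) / c))
    ∂(Measure.pi fun _ => paretoMeasure 1 (τ - 1))

/-- Two edges could coincide only if traversed in opposite directions, forcing `1 + 1 = 0`, which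
fails for three or more vertices. Distinct pairs carry independent uniform variables. -/
lemma sym2_cycle_injective {m : ℕ} {V : Type*} (σ : Fin (m + 3) ↪ V) :
    Function.Injective fun i => s(σ i, σ (i + 1)) := by
  intro i j hij
  rw [Sym2.eq_iff] at hij
  rcases hij with ⟨h, -⟩ | ⟨h, h'⟩
  · exact σ.injective h
  · have h1 := σ.injective h
    have h2 := σ.injective h'
    rw [h1, add_assoc] at h2
    exact absurd (add_eq_left.1 h2) (ne_of_beq_false rfl)

/-- The event that all edges of the closed walk `σ 0, σ 1, …, σ 0` are present. -/
def cycleEvent (τ : ℝ) (g : ℝ → ℝ) (m n : ℕ) (σ : Fin (m + 3) ↪ Fin n) : Set (Sample n) :=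
  {ω | ∀ i, (ω.2 s(σ i, σ (i + 1)) : ℝ) < g (ω.1 (σ i) * ω.1 (σ (i + 1)) / gam τ n ^ 2)}

lemma measurableSet_cycleEvent {τ : ℝ} {g : ℝ → ℝ} (hg : Measurable g) (m n : ℕ)
    (σ : Fin (m + 3) ↪ Fin n) : MeasurableSet (cycleEvent τ g m n σ) := by
  rw [cycleEvent, Set.ofPred_forall]
  refine MeasurableSet.iInter fun i => measurableSet_lt ?_ ?_
  · fun_prop
  · refine hg.comp ?_
    fun_prop

lemma sampleLaw_cycleEvent {τ : ℝ} (hτ : 1 < τ) {g : ℝ → ℝ} (hg : Measurable g)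
    (hg0 : ∀ x, 0 ≤ g x) (hg1 : ∀ x, g x ≤ 1) (m n : ℕ) (σ : Fin (m + 3) ↪ Fin n) :
    sampleLaw τ n (cycleEvent τ g m n σ) = cycleProb τ g (m + 2) (gam τ n ^ 2) := by
  have := isProbabilityMeasure_paretoMeasure one_pos (sub_pos.2 hτ)
  have hmp := (measurePreserving_comp_injective (paretoMeasure 1 (τ - 1)) σ.injective).prod
    (measurePreserving_comp_injective (volume : Measure unitInterval) (sym2_cycle_injective σ))
  set B : Set ((Fin (m + 3) → ℝ) × (Fin (m + 3) → unitInterval)) :=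
    {p | ∀ i, (p.2 i : ℝ) < g (p.1 i * p.1 (i + 1) / gam τ n ^ 2)} with hB
  have hBm : MeasurableSet B := by
    rw [hB, Set.ofPred_forall]
    refine MeasurableSet.iInter fun i => measurableSet_lt (by fun_prop) (hg.comp (by fun_prop))
  have h := hmp.measure_preimage hBm.nullMeasurableSet
  refine h.trans ?_
  rw [Measure.prod_apply hBm, cycleProb]
  refine lintegral_congr fun x => ?_
  -- For fixed weights the edge conditions concern separate coordinates, so the slice is a box and
  -- its measure a product.
  have : Prod.mk x ⁻¹' B = Set.pi Set.univ
      fun i => {u : unitInterval | (u : ℝ) < g (x i * x (i + 1) / gam τ n ^ 2)} := by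
    ext U
    simp [B]
  rw [this, Measure.pi_pi]
  exact Finset.prod_congr rfl fun i _ => volume_unitInterval_lt (hg0 _) (hg1 _)

/-- The events on the right detect the labelled copies of the cycle, and each unlabelled copy
accounts for `2 * (m + 3)` of them. -/
lemma cycleCount_eq_sum_indicator (τ : ℝ) (g : ℝ → ℝ) (m n : ℕ) (ω : Sample n) :
    cycleCount τ g (m + 3) n ω = (2 * (m + 3 : ℝ))⁻¹ *
      ∑ σ : Fin (m + 3) ↪ Fin n, (cycleEvent τ g m n σ).indicator (fun _ => (1 : ℝ)) ω := by
  classical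
  have h1 := SimpleGraph.card_copy_eq_copyCount_mul_card_iso (randomGraph τ g n ω)
    (SimpleGraph.cycleGraph (m + 3))
  rw [SimpleGraph.card_cycleGraph_iso] at h1
  have h2 : Nat.card (SimpleGraph.Copy (SimpleGraph.cycleGraph (m + 3)) (randomGraph τ g n ω)) =
      (Finset.univ.filter fun σ : Fin (m + 3) ↪ Fin n => ω ∈ cycleEvent τ g m n σ).card := by
    rw [← Fintype.card_subtype, ← Nat.card_eq_fintype_card]
    refine Nat.card_congr
      { toFun := fun c => ⟨c.toEmbedding, fun i => ?_⟩
        invFun := fun σ => ⟨⟨σ.1, fun {a b} hab => ?_⟩, σ.1.injective⟩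
        left_inv := fun c => rfl
        right_inv := fun σ => rfl }
    · exact (c.toHom.map_adj (SimpleGraph.cycleGraph_adj.2
        (Or.inr (add_sub_cancel_left i 1)))).2
    · have key : ∀ i : Fin (m + 3), (randomGraph τ g n ω).Adj (σ.1 i) (σ.1 (i + 1)) :=
        fun i => ⟨fun h => absurd (add_eq_left.1 (σ.1.injective h).symm)
          (ne_of_beq_false rfl), σ.2 i⟩
      rcases SimpleGraph.cycleGraph_adj.1 hab with h | h
      · rw [sub_eq_iff_eq_add'] at h
        subst h
        exact (key b).symm
      · rw [sub_eq_iff_eq_add'] at h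
        subst h
        exact key a
  have h3 : ∑ σ : Fin (m + 3) ↪ Fin n, (cycleEvent τ g m n σ).indicator (fun _ => (1 : ℝ)) ω =
      ((randomGraph τ g n ω).copyCount (SimpleGraph.cycleGraph (m + 3)) : ℝ) *
        (2 * (m + 3 : ℝ)) := by
    rw [h2] at h1
    rw [← Nat.cast_inj (R := ℝ), Finset.card_filter] at h1
    push_cast at h1
    rw [← h1]
    exact Finset.sum_congr rfl fun σ _ => by simp [Set.indicator_apply]
  rw [h3, cycleCount]
  field_simp

lemma isProbabilityMeasure_sampleLaw {τ : ℝ} (hτ : 1 < τ) (n : ℕ) :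
    IsProbabilityMeasure (sampleLaw τ n) := by
  have := isProbabilityMeasure_paretoMeasure one_pos (sub_pos.2 hτ)
  unfold sampleLaw
  infer_instance

lemma integrable_cycleCount_of_measurable {τ : ℝ} (hτ : 1 < τ) {g : ℝ → ℝ} (hg : Measurable g)
    (m n : ℕ) : Integrable (cycleCount τ g (m + 3) n) (sampleLaw τ n) := by
  have := isProbabilityMeasure_sampleLaw hτ n
  rw [funext (cycleCount_eq_sum_indicator τ g m n)]
  refine (integrable_finsetSum _ fun σ _ => ?_).const_mul _
  exact (integrable_const 1).indicator (measurableSet_cycleEvent hg m n σ)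

lemma avgCycles_of_measurable {τ : ℝ} (hτ : 1 < τ) {g : ℝ → ℝ} (hg : Measurable g)
    (hg0 : ∀ x, 0 ≤ g x) (hg1 : ∀ x, g x ≤ 1) (m n : ℕ) :
    avgCycles τ g (m + 3) n = (2 * (m + 3 : ℝ))⁻¹ * ((n.choose (m + 3) : ℝ) * ((m + 3).factorial : ℝ))
      * (cycleProb τ g (m + 2) (gam τ n ^ 2)).toReal := by
  have := isProbabilityMeasure_sampleLaw hτ n
  rw [avgCycles, funext (cycleCount_eq_sum_indicator τ g m n), integral_const_mul,
    integral_finsetSum _ fun σ _ =>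
      (integrable_const (1 : ℝ)).indicator (measurableSet_cycleEvent hg m n σ)]
  have h : ∀ σ : Fin (m + 3) ↪ Fin n, ∫ ω, (cycleEvent τ g m n σ).indicator (fun _ => (1 : ℝ)) ω
      ∂(sampleLaw τ n) = (cycleProb τ g (m + 2) (gam τ n ^ 2)).toReal := by
    intro σ
    rw [integral_indicator_const _ (measurableSet_cycleEvent hg m n σ), measureReal_def,
      sampleLaw_cycleEvent hτ hg hg0 hg1, smul_eq_mul, mul_one]
  rw [Finset.sum_congr rfl fun σ _ => h σ, Finset.sum_const, Finset.card_univ,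
    Fintype.card_embedding_eq, Fintype.card_fin, Fintype.card_fin, nsmul_eq_mul,
    Nat.descFactorial_eq_factorial_mul_choose]
  push_cast
  ring

lemma ae_paretoMeasure_one_le (r : ℝ) : ∀ᵐ x ∂(paretoMeasure 1 r), 1 ≤ x := by
  rw [paretoMeasure, ae_withDensity_iff (by unfold paretoPDF; fun_prop)]
  refine ae_of_all _ fun x hx => ?_
  by_contra h
  exact hx (paretoPDF_of_lt (not_le.1 h))

lemma ae_sampleLaw_one_le {τ : ℝ} (hτ : 1 < τ) (n : ℕ) :
    ∀ᵐ ω ∂(sampleLaw τ n), ∀ i, 1 ≤ ω.1 i := by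
  have := isProbabilityMeasure_paretoMeasure one_pos (sub_pos.2 hτ)
  have h : ∀ᵐ h ∂(Measure.pi fun _ : Fin n => paretoMeasure 1 (τ - 1)), ∀ i, 1 ≤ h i :=
    ae_all_iff.2 fun i =>
      (measurePreserving_eval (fun _ : Fin n => paretoMeasure 1 (τ - 1)) i).quasiMeasurePreserving.ae
        (ae_paretoMeasure_one_le _)
  exact Measure.quasiMeasurePreserving_fst.ae h

/-- Allows `f`, arbitrary and possibly non-measurable on the negative axis, to be replaced by a
measurable function: weights are almost surely at least `1`, so no edge changes. -/
lemma cycleCount_congr_ae {τ : ℝ} (hτ : 1 < τ) {f g : ℝ → ℝ} (hfg : ∀ x, 0 ≤ x → f x = g x)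
    (k n : ℕ) : cycleCount τ f k n =ᵐ[sampleLaw τ n] cycleCount τ g k n := by
  filter_upwards [ae_sampleLaw_one_le hτ n] with ω hω
  have : randomGraph τ f n ω = randomGraph τ g n ω := by
    ext i j
    have hij : 0 ≤ ω.1 i * ω.1 j / gam τ n ^ 2 :=
      div_nonneg (mul_nonneg (zero_le_one.trans (hω i)) (zero_le_one.trans (hω j))) (sq_nonneg _)
    simp only [randomGraph, hfg _ hij]
  rw [cycleCount, cycleCount, this]

/-! ### Integrals along paths as operator iterates -/

lemma lintegral_fin_succ {m : ℕ} {F : (Fin (m + 1) → ℝ) → ℝ≥0∞} (hF : Measurable F) :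
    ∫⁻ u, F u = ∫⁻ x : ℝ, ∫⁻ w : Fin m → ℝ, F (Fin.cons x w) := by
  have h := (volume_preserving_piFinSuccAbove (fun _ : Fin (m + 1) => ℝ) 0).symm
  rw [← h.lintegral_comp hF, Measure.volume_eq_prod,
    lintegral_prod (fun p => F ((MeasurableEquiv.piFinSuccAbove (fun _ => ℝ) 0).symm p))
      (hF.comp (MeasurableEquiv.measurable _)).aemeasurable]
  refine lintegral_congr fun x => lintegral_congr fun w => congrArg F ?_
  exact Fin.insertNth_zero' x w

lemma measurable_finCons {m : ℕ} :
    Measurable fun p : ℝ × (Fin m → ℝ) => (Fin.cons p.1 p.2 : Fin (m + 1) → ℝ) := by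
  rw [measurable_pi_iff]
  intro i
  refine Fin.cases ?_ (fun i => ?_) i
  · simpa using measurable_fst
  · simpa using measurable_snd.eval (a := i)

@[fun_prop]
lemma measurable_finCons_right {m : ℕ} (x : ℝ) (i : Fin (m + 1)) :
    Measurable fun w : Fin m → ℝ => (Fin.cons x w : Fin (m + 1) → ℝ) i :=
  (measurable_pi_apply i).comp (measurable_finCons.comp measurable_prodMk_left)

/-- The integral operator with kernel `K (x + y)`. -/
noncomputable def hankel (K h : ℝ → ℝ≥0∞) (x : ℝ) : ℝ≥0∞ := ∫⁻ y, K (x + y) * h y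

@[fun_prop]
lemma measurable_hankel {K h : ℝ → ℝ≥0∞} (hK : Measurable K) (hh : Measurable h) :
    Measurable (hankel K h) :=
  Measurable.lintegral_prod_right' (f := fun p : ℝ × ℝ => K (p.1 + p.2) * h p.2) (by fun_prop)

lemma measurable_hankel_iterate {K h : ℝ → ℝ≥0∞} (hK : Measurable K) (hh : Measurable h) (m : ℕ) :
    Measurable ((hankel K)^[m] h) := by
  induction m with
  | zero => exact hh
  | succ m ih => rw [Function.iterate_succ_apply']; exact measurable_hankel hK ih

/-- Tonelli and translation invariance; iterated, this makes the dominating function in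
`tendsto_cycleIntegral_div` integrable. -/
lemma lintegral_hankel {K h : ℝ → ℝ≥0∞} (hK : Measurable K) (hh : Measurable h) :
    ∫⁻ x, hankel K h x = (∫⁻ x, K x) * ∫⁻ x, h x := by
  simp only [hankel]
  rw [lintegral_lintegral_swap (by fun_prop), ← lintegral_const_mul _ hh]
  refine lintegral_congr fun y => ?_
  rw [lintegral_mul_const _ (by fun_prop), lintegral_add_right_eq_self]

lemma lintegral_hankel_iterate {K h : ℝ → ℝ≥0∞} (hK : Measurable K) (hh : Measurable h) (m : ℕ) :
    ∫⁻ x, (hankel K)^[m] h x = (∫⁻ x, K x) ^ m * ∫⁻ x, h x := by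
  induction m with
  | zero => simp
  | succ m ih =>
    rw [Function.iterate_succ_apply', lintegral_hankel hK (measurable_hankel_iterate hK hh m), ih,
      pow_succ', mul_assoc]

/-- The product of the kernel along a path. -/
noncomputable def pathWeight (K : ℝ → ℝ≥0∞) {m : ℕ} (w : Fin (m + 1) → ℝ) : ℝ≥0∞ :=
  ∏ i : Fin m, K (w i.castSucc + w i.succ)

@[fun_prop]
lemma measurable_pathWeight {K : ℝ → ℝ≥0∞} (hK : Measurable K) {m : ℕ} :
    Measurable (pathWeight K (m := m)) := by
  unfold pathWeight
  fun_prop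

lemma pathWeight_cons (K : ℝ → ℝ≥0∞) {m : ℕ} (x : ℝ) (w : Fin (m + 1) → ℝ) :
    pathWeight K (Fin.cons x w : Fin (m + 2) → ℝ) = K (x + w 0) * pathWeight K w := by
  rw [pathWeight, Fin.prod_univ_succ, pathWeight]
  congr 1

/-- Integrating over the vertex next to `x` is one application of the operator to the same integral
for a shorter path. -/
lemma lintegral_pathWeight {K : ℝ → ℝ≥0∞} (hK : Measurable K) {h : ℝ → ℝ≥0∞} (hh : Measurable h)
    (m : ℕ) (x : ℝ) :
    ∫⁻ w : Fin m → ℝ, pathWeight K (Fin.cons x w : Fin (m + 1) → ℝ) *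
      h ((Fin.cons x w : Fin (m + 1) → ℝ) (Fin.last m)) = (hankel K)^[m] h x := by
  induction m generalizing x with
  | zero =>
    rw [lintegral_unique]
    simp [pathWeight, volume_pi]
  | succ m ih =>
    rw [lintegral_fin_succ, Function.iterate_succ_apply', hankel]
    · refine lintegral_congr fun y => ?_
      rw [← ih, ← lintegral_const_mul]
      · refine lintegral_congr fun w => ?_
        rw [pathWeight_cons, ← mul_assoc]
        rfl
      · have : Measurable fun w : Fin m → ℝ => (Fin.cons y w : Fin (m + 1) → ℝ) :=
          measurable_finCons.comp measurable_prodMk_left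
        fun_prop
    · have : Measurable fun w : Fin (m + 1) → ℝ => (Fin.cons x w : Fin (m + 2) → ℝ) :=
          measurable_finCons.comp measurable_prodMk_left
      fun_prop

/-! ### Closed walks and alternating translations -/

/-- The product of the kernel along a closed walk. -/
noncomputable def cycleWeight (K : ℝ → ℝ≥0∞) {m : ℕ} (u : Fin (m + 1) → ℝ) : ℝ≥0∞ :=
  ∏ i, K (u i + u (i + 1))

@[fun_prop]
lemma measurable_cycleWeight {K : ℝ → ℝ≥0∞} (hK : Measurable K) {m : ℕ} :
    Measurable (cycleWeight K (m := m)) := by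
  unfold cycleWeight
  fun_prop

lemma cycleWeight_eq (K : ℝ → ℝ≥0∞) {m : ℕ} (u : Fin (m + 1) → ℝ) :
    cycleWeight K u = pathWeight K u * K (u (Fin.last m) + u 0) := by
  rw [cycleWeight, Fin.prod_univ_castSucc, pathWeight]
  congr 1
  · exact Finset.prod_congr rfl fun i _ => by rw [Fin.coeSucc_eq_succ]
  · rw [Fin.last_add_one]

/-- The integral over `[-L, ∞) ^ (m + 1)` of the product of the kernel along a closed walk. -/
noncomputable def cycleIntegral (K : ℝ → ℝ≥0∞) (m : ℕ) (L : ℝ) : ℝ≥0∞ :=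
  ∫⁻ u : Fin (m + 1) → ℝ, {u | ∀ i, -L ≤ u i}.indicator 1 u * cycleWeight K u

/-- Consecutive shifts cancel in each sum. At the closing edge the signs are `(-1)^m` and `1`, which
cancel because `m` is odd: this is where the even cycle length enters. -/
lemma cycleWeight_add_alternating (K : ℝ → ℝ≥0∞) {m : ℕ} (hm : Odd m) (u : Fin (m + 1) → ℝ)
    (t : ℝ) : cycleWeight K (fun i => u i + (-1) ^ (i : ℕ) * t) = cycleWeight K u := by
  rw [cycleWeight_eq, cycleWeight_eq, pathWeight, pathWeight]
  congr 1
  · refine Finset.prod_congr rfl fun i _ => ?_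
    congr 1
    simp only [Fin.val_castSucc, Fin.val_succ, pow_succ]
    ring
  · congr 1
    simp only [Fin.val_last, Fin.val_zero, hm.neg_one_pow]
    ring

/-- The set of admissible alternating translations of a closed walk. -/
def shiftSet {m : ℕ} (L : ℝ) (w : Fin m → ℝ) : Set ℝ :=
  {t | ∀ i : Fin (m + 1), -L ≤ (Fin.cons 0 w : Fin (m + 1) → ℝ) i + (-1) ^ (i : ℕ) * t}

lemma measurableSet_shiftSet {m : ℕ} (L : ℝ) (w : Fin m → ℝ) : MeasurableSet (shiftSet L w) := by
  rw [shiftSet, Set.ofPred_forall]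
  exact MeasurableSet.iInter fun i => measurableSet_le (by fun_prop) (by fun_prop)

lemma measurableSet_shiftSet_prod (m : ℕ) (L : ℝ) :
    MeasurableSet {p : (Fin m → ℝ) × ℝ | p.2 ∈ shiftSet L p.1} := by
  simp only [shiftSet, Set.mem_ofPred_eq]
  rw [Set.ofPred_forall]
  refine MeasurableSet.iInter fun i => measurableSet_le (by fun_prop) ?_
  have : Measurable fun p : (Fin m → ℝ) × ℝ => (Fin.cons 0 p.1 : Fin (m + 1) → ℝ) i :=
    (measurable_finCons_right 0 i).comp measurable_fst
  fun_prop

/-- In coordinates adapted to the invariance, `t = u 0` runs along an orbit and enters only through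
the constraint, while `w` labels the orbit. -/
lemma cycleIntegral_eq {K : ℝ → ℝ≥0∞} (hK : Measurable K) {m : ℕ} (hm : Odd m) (L : ℝ) :
    cycleIntegral K m L = ∫⁻ w : Fin m → ℝ, volume (shiftSet L w) *
      cycleWeight K (Fin.cons 0 w : Fin (m + 1) → ℝ) := by
  have hset : MeasurableSet {u : Fin (m + 1) → ℝ | ∀ i, -L ≤ u i} := by
    rw [Set.ofPred_forall]
    exact MeasurableSet.iInter fun i => measurableSet_le (by fun_prop) (by fun_prop)
  have hF : Measurable fun u : Fin (m + 1) → ℝ =>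
      {u | ∀ i, -L ≤ u i}.indicator 1 u * cycleWeight K u :=
    (measurable_one.indicator hset).mul (measurable_cycleWeight hK)
  have hcons : ∀ (t : ℝ) (w : Fin m → ℝ),
      (Fin.cons t (w + fun i : Fin m => (-1) ^ ((i : ℕ) + 1) * t) : Fin (m + 1) → ℝ) =
      fun i => (Fin.cons 0 w : Fin (m + 1) → ℝ) i + (-1) ^ (i : ℕ) * t := by
    intro t w
    funext i
    refine Fin.cases ?_ (fun i => ?_) i <;> simp
  have hcons0 : Measurable fun w : Fin m → ℝ => (Fin.cons 0 w : Fin (m + 1) → ℝ) :=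
    measurable_finCons.comp measurable_prodMk_left
  calc cycleIntegral K m L
      = ∫⁻ t : ℝ, ∫⁻ w : Fin m → ℝ, (shiftSet L w).indicator 1 t *
          cycleWeight K (Fin.cons 0 w : Fin (m + 1) → ℝ) := by
        rw [cycleIntegral, lintegral_fin_succ hF]
        refine lintegral_congr fun t => ?_
        rw [← lintegral_add_right_eq_self _ (fun i : Fin m => (-1) ^ ((i : ℕ) + 1) * t)]
        refine lintegral_congr fun w => ?_
        rw [hcons, cycleWeight_add_alternating K hm]
        rfl
    _ = ∫⁻ w : Fin m → ℝ, ∫⁻ t : ℝ, (shiftSet L w).indicator 1 t *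
          cycleWeight K (Fin.cons 0 w : Fin (m + 1) → ℝ) := by
        refine lintegral_lintegral_swap (Measurable.aemeasurable ?_)
        refine Measurable.mul ?_ (((measurable_cycleWeight hK).comp hcons0).comp measurable_snd)
        exact measurable_one.indicator (measurableSet_shiftSet_prod m L |>.preimage measurable_swap)
    _ = _ := by
        refine lintegral_congr fun w => ?_
        rw [lintegral_mul_const]
        · congr 1
          exact lintegral_indicator_one (measurableSet_shiftSet L w)
        · exact measurable_one.indicator (measurableSet_shiftSet L w)

lemma volume_shiftSet_le {m : ℕ} (L : ℝ) (w : Fin (m + 1) → ℝ) :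
    volume (shiftSet L w) ≤ ENNReal.ofReal (2 * L + |w 0|) := by
  -- The constraints at vertices `0` and `1` alone bound `t` from both sides.
  have : shiftSet L w ⊆ Set.Icc (-L) (L + w 0) := by
    intro t ht
    have h0 := ht 0
    have h1 := ht 1
    have e : (Fin.cons 0 w : Fin (m + 2) → ℝ) 1 = w 0 := Fin.cons_succ _ _ 0
    simp only [Fin.cons_zero, Fin.val_zero, pow_zero, Fin.val_one, pow_one, e] at h0 h1
    constructor <;> linarith
  refine (measure_mono this).trans ?_
  rw [Real.volume_Icc]
  exact ENNReal.ofReal_le_ofReal (by linarith [le_abs_self (w 0)])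

lemma le_volume_shiftSet {m : ℕ} (L : ℝ) (w : Fin m → ℝ) :
    ENNReal.ofReal (2 * L - 2 * ‖w‖) ≤ volume (shiftSet L w) := by
  have : Set.Icc (-(L - ‖w‖)) (L - ‖w‖) ⊆ shiftSet L w := by
    rintro t ⟨h1, h2⟩ i
    have hW : |(Fin.cons 0 w : Fin (m + 1) → ℝ) i| ≤ ‖w‖ := by
      refine Fin.cases ?_ (fun i => ?_) i
      · simp
      · simpa using norm_le_pi_norm w i
    have ht : |(-1) ^ (i : ℕ) * t| ≤ L - ‖w‖ := by
      rw [abs_mul, abs_neg_one_pow, one_mul]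
      exact abs_le.2 ⟨h1, h2⟩
    linarith [neg_abs_le ((Fin.cons 0 w : Fin (m + 1) → ℝ) i), neg_abs_le ((-1) ^ (i : ℕ) * t)]
  refine le_trans ?_ (measure_mono this)
  rw [Real.volume_Icc]
  exact ENNReal.ofReal_le_ofReal (by linarith)

lemma tendsto_volume_shiftSet_div {m : ℕ} (w : Fin (m + 1) → ℝ) :
    Tendsto (fun L => volume (shiftSet L w) / ENNReal.ofReal (2 * L)) atTop (𝓝 1) := by
  have hlim : ∀ c : ℝ, Tendsto (fun L => ENNReal.ofReal ((2 * L + c) / (2 * L))) atTop (𝓝 1) := by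
    intro c
    rw [← ENNReal.ofReal_one]
    refine ENNReal.tendsto_ofReal ?_
    have h : Tendsto (fun L : ℝ => 1 + c / (2 * L)) atTop (𝓝 (1 + 0)) :=
      tendsto_const_nhds.add (tendsto_const_nhds.div_atTop
        (tendsto_id.const_mul_atTop zero_lt_two))
    rw [add_zero] at h
    refine h.congr' ?_
    filter_upwards [eventually_gt_atTop 0] with L hL
    field_simp
  refine tendsto_of_tendsto_of_tendsto_of_le_of_le' (hlim (-(2 * ‖w‖))) (hlim |w 0|) ?_ ?_
  · filter_upwards [eventually_gt_atTop 0] with L hL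
    rw [ENNReal.ofReal_div_of_pos (by positivity), ← sub_eq_add_neg]
    exact ENNReal.div_le_div_right (le_volume_shiftSet L w) _
  · filter_upwards [eventually_gt_atTop 0] with L hL
    rw [ENNReal.ofReal_div_of_pos (by positivity)]
    exact ENNReal.div_le_div_right (volume_shiftSet_le L w) _

lemma measurable_volume_shiftSet (m : ℕ) (L : ℝ) :
    Measurable fun w : Fin m → ℝ => volume (shiftSet L w) :=
  measurable_measure_prodMk_left (measurableSet_shiftSet_prod m L)

/-- Dominated convergence over orbits. The excess `|w 0|` in the orbit length is absorbed by the
edge factor `K (w 0)` through `hKC`, leaving an open path of finite total mass. -/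
theorem tendsto_cycleIntegral_div {K : ℝ → ℝ≥0∞} (hK : Measurable K) {m : ℕ} (hm : Odd m)
    {C : ℝ≥0∞} (hC : C ≠ ∞) (hKC : ∀ x, ENNReal.ofReal (1 + |x|) * K x ≤ C)
    (hint : ∫⁻ x, K x ≠ ∞) :
    Tendsto (fun L => cycleIntegral K m L / ENNReal.ofReal (2 * L)) atTop
      (𝓝 ((hankel K)^[m] K 0)) := by
  obtain ⟨p, rfl⟩ : ∃ p, m = p + 1 := ⟨m - 1, by have := hm.pos; omega⟩
  have hcons0 : Measurable fun w : Fin (p + 1) → ℝ => (Fin.cons 0 w : Fin (p + 2) → ℝ) :=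
    measurable_finCons.comp measurable_prodMk_left
  have hcw : Measurable fun w : Fin (p + 1) → ℝ => cycleWeight K (Fin.cons 0 w : Fin (p + 2) → ℝ) :=
    (measurable_cycleWeight hK).comp hcons0
  have hlim : (hankel K)^[p + 1] K 0 =
      ∫⁻ w : Fin (p + 1) → ℝ, cycleWeight K (Fin.cons 0 w : Fin (p + 2) → ℝ) := by
    rw [← lintegral_pathWeight hK hK]
    refine lintegral_congr fun w => ?_
    rw [cycleWeight_eq, Fin.cons_zero, add_zero]
  rw [hlim]
  have heq : (fun L => cycleIntegral K (p + 1) L / ENNReal.ofReal (2 * L)) = fun L =>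
      ∫⁻ w : Fin (p + 1) → ℝ, volume (shiftSet L w) / ENNReal.ofReal (2 * L) *
        cycleWeight K (Fin.cons 0 w : Fin (p + 2) → ℝ) := by
    funext L
    rw [cycleIntegral_eq hK hm, div_eq_mul_inv, mul_comm, ← lintegral_const_mul]
    · refine lintegral_congr fun w => ?_
      rw [div_eq_mul_inv]
      ring
    · exact (measurable_volume_shiftSet _ L).mul hcw
  rw [heq]
  have hbound : ∫⁻ w : Fin (p + 1) → ℝ, C * (pathWeight K w * K (w (Fin.last p))) ≠ ∞ := by
    rw [lintegral_const_mul _ (by fun_prop), lintegral_fin_succ (by fun_prop)]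
    simp_rw [lintegral_pathWeight hK hK]
    rw [lintegral_hankel_iterate hK hK]
    exact ENNReal.mul_ne_top hC (ENNReal.mul_ne_top (ENNReal.pow_ne_top hint) hint)
  refine tendsto_lintegral_filter_of_dominated_convergence
    (fun w => C * (pathWeight K w * K (w (Fin.last p)))) ?_ ?_ hbound ?_
  · exact Eventually.of_forall fun L =>
      ((measurable_volume_shiftSet _ L).div_const _).mul hcw
  · filter_upwards [eventually_ge_atTop 1] with L hL
    refine ae_of_all _ fun w => ?_
    have h1 : volume (shiftSet L w) / ENNReal.ofReal (2 * L) ≤ ENNReal.ofReal (1 + |w 0|) := by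
      refine (ENNReal.div_le_div_right (volume_shiftSet_le L w) _).trans ?_
      rw [← ENNReal.ofReal_div_of_pos (by positivity)]
      refine ENNReal.ofReal_le_ofReal ?_
      rw [div_le_iff₀ (by positivity)]
      nlinarith [abs_nonneg (w 0)]
    rw [cycleWeight_eq, pathWeight_cons, Fin.cons_zero, add_zero, zero_add]
    calc _ ≤ ENNReal.ofReal (1 + |w 0|) * (K (w 0) * pathWeight K w * K (w (Fin.last p))) := by
          gcongr
          exact le_rfl
      _ = (ENNReal.ofReal (1 + |w 0|) * K (w 0)) * (pathWeight K w * K (w (Fin.last p))) := by ring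
      _ ≤ _ := by
          gcongr
          exact hKC _
  · refine ae_of_all _ fun w => ?_
    have hfin : cycleWeight K (Fin.cons 0 w : Fin (p + 2) → ℝ) ≠ ∞ := by
      refine ENNReal.prod_ne_top fun i _ => ne_top_of_le_ne_top hC (le_trans ?_
        (hKC ((Fin.cons 0 w : Fin (p + 2) → ℝ) i + (Fin.cons 0 w : Fin (p + 2) → ℝ) (i + 1))))
      refine le_mul_of_one_le_left zero_le ?_
      rw [ENNReal.one_le_ofReal]
      linarith [abs_nonneg ((Fin.cons 0 w : Fin (p + 2) → ℝ) i +
        (Fin.cons 0 w : Fin (p + 2) → ℝ) (i + 1))]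
    have := ENNReal.Tendsto.mul_const (tendsto_volume_shiftSet_div w) (Or.inr hfin)
    rwa [one_mul] at this

end RankOneGraph

/-! ### Fourier inversion at the origin -/

/-- Gaussian summation of the Fourier transform at the origin. -/
lemma Real.tendsto_integral_gaussian_smul_fourier {φ : ℝ → ℂ} (hφ : Integrable φ)
    (hc : ContinuousAt φ 0) :
    Tendsto (fun c : ℝ => ∫ w, Complex.exp (-c⁻¹ * ‖w‖ ^ 2) • 𝓕 φ w) atTop (𝓝 (φ 0)) := by
  refine (Real.tendsto_integral_gaussian_smul' hφ hc).congr' ?_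
  filter_upwards [Ioi_mem_atTop 0] with c (hc : 0 < c)
  have hJ : Integrable (fun w : ℝ => Complex.exp (-c⁻¹ * ‖w‖ ^ 2)) := by
    simpa using GaussianFourier.integrable_cexp_neg_mul_sq_norm_add (V := ℝ)
      (b := (c⁻¹ : ℂ)) (by simpa) 0 0
  -- Self-adjointness moves the Fourier transform from the Gaussian to `φ`.
  have h : ∫ w : ℝ, 𝓕 (fun w : ℝ => Complex.exp (-c⁻¹ * ‖w‖ ^ 2)) w • φ w =
      ∫ w, Complex.exp (-c⁻¹ * ‖w‖ ^ 2) • 𝓕 φ w := by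
    simpa using! VectorFourier.integral_fourierIntegral_smul_eq_flip (L := innerₗ ℝ)
      Real.continuous_fourierChar continuous_inner hJ hφ
  refine Eq.trans ?_ h
  congr with w
  congr 1
  have := fourier_gaussian_innerProductSpace' (V := ℝ) (b := ((c⁻¹ : ℝ) : ℂ))
    (by simpa) 0 w
  simp only [inner_zero_left, Complex.ofReal_zero, mul_zero, add_zero] at this
  refine Eq.trans ?_ this.symm
  simp only [Complex.ofReal_inv, div_inv_eq_mul]
  congr 2
  ring

/-- A nonnegative Fourier transform of an integrable function continuous at `0` is integrable. -/
lemma Real.integral_fourier_of_nonneg {φ : ℝ → ℂ} (hφ : Integrable φ) (hc : ContinuousAt φ 0)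
    {g : ℝ → ℝ} (hg : ∀ v, 0 ≤ g v) (h : ∀ v, 𝓕 φ v = (g v : ℂ)) :
    Integrable g ∧ ((∫ v, g v : ℝ) : ℂ) = φ 0 := by
  have hcont : Continuous (𝓕 φ) :=
    VectorFourier.fourierIntegral_continuous Real.continuous_fourierChar continuous_inner hφ
  have hgcont : Continuous g := by
    have : g = fun v => (𝓕 φ v).re := by
      funext v
      rw [h, Complex.ofReal_re]
    rw [this]
    exact Complex.continuous_re.comp hcont
  have hlim := Real.tendsto_integral_gaussian_smul_fourier hφ hc
  have hbound : ∀ v, |g v| ≤ ∫ x, ‖φ x‖ := by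
    intro v
    have := VectorFourier.norm_fourierIntegral_le_integral_norm Real.fourierChar volume
      (innerₗ ℝ) φ v
    rw [← Real.norm_eq_abs, ← Complex.norm_real, ← h]
    exact this
  have hint : ∀ c : ℝ, 0 < c → Integrable fun w : ℝ => Real.exp (-c⁻¹ * w ^ 2) * g w := by
    intro c hc
    exact (integrable_exp_neg_mul_sq (inv_pos.2 hc)).mul_bdd hgcont.aestronglyMeasurable
      (ae_of_all _ fun v => hbound v)
  have heq : ∀ c : ℝ, ∫ w, Complex.exp (-c⁻¹ * ‖w‖ ^ 2) • 𝓕 φ w =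
      ((∫ w, Real.exp (-c⁻¹ * w ^ 2) * g w : ℝ) : ℂ) := by
    intro c
    rw [← integral_complex_ofReal]
    congr with w
    rw [h, Real.norm_eq_abs, ← Complex.ofReal_pow, sq_abs]
    simp
  simp_rw [heq] at hlim
  have hre : Tendsto (fun c : ℝ => ∫ w, Real.exp (-c⁻¹ * w ^ 2) * g w) atTop (𝓝 (φ 0).re) := by
    simpa only [Function.comp_def, Complex.ofReal_re] using
      (Complex.continuous_re.tendsto _).comp hlim
  -- Fatou: the Gaussian-damped integrals converge to `(φ 0).re`, which bounds the integral of the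
  -- nonnegative `g`.
  have hgi : Integrable g := by
    refine ⟨hgcont.aestronglyMeasurable, ?_⟩
    rw [hasFiniteIntegral_iff_ofReal (ae_of_all _ hg)]
    have hF := lintegral_liminf_le (μ := volume) (u := atTop)
      (f := fun (n : ℕ) w => ENNReal.ofReal (Real.exp (-(n : ℝ)⁻¹ * w ^ 2) * g w))
      (fun n => by fun_prop)
    have h1 : ∀ w, liminf (fun n : ℕ => ENNReal.ofReal (Real.exp (-(n : ℝ)⁻¹ * w ^ 2) * g w))
        atTop = ENNReal.ofReal (g w) := by
      intro w
      refine Tendsto.liminf_eq (ENNReal.tendsto_ofReal ?_)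
      have h2 : Tendsto (fun n : ℕ => Real.exp (-(n : ℝ)⁻¹ * w ^ 2) * g w) atTop
          (𝓝 (Real.exp (-0 * w ^ 2) * g w)) :=
        ((Real.continuous_exp.tendsto _).comp
          ((tendsto_inv_atTop_nhds_zero_nat (𝕜 := ℝ)).neg.mul_const _)).mul_const _
      simpa using h2
    have h3 : Tendsto (fun n : ℕ => ∫⁻ w, ENNReal.ofReal (Real.exp (-(n : ℝ)⁻¹ * w ^ 2) * g w))
        atTop (𝓝 (ENNReal.ofReal (φ 0).re)) := by
      refine (ENNReal.tendsto_ofReal (hre.comp tendsto_natCast_atTop_atTop)).congr' ?_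
      filter_upwards [eventually_gt_atTop 0] with n hn
      exact ofReal_integral_eq_lintegral_ofReal (hint n (Nat.cast_pos.2 hn))
        (ae_of_all _ fun w => mul_nonneg (Real.exp_nonneg _) (hg w))
    simp_rw [h1] at hF
    rw [h3.liminf_eq] at hF
    exact hF.trans_lt ENNReal.ofReal_lt_top
  refine ⟨hgi, ?_⟩
  have h4 := Real.tendsto_integral_cexp_sq_smul (V := ℝ) (hgi.ofReal (𝕜 := ℂ))
  rw [← integral_complex_ofReal]
  refine tendsto_nhds_unique h4 (hlim.congr fun c => ?_)
  rw [← heq]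
  congr with w
  rw [h]
  rfl

lemma Real.fourier_comp_neg (h : ℝ → ℂ) (v : ℝ) : 𝓕 (fun x => h (-x)) v = 𝓕 h (-v) := by
  rw [Real.fourier_real_eq, Real.fourier_real_eq, ← integral_neg_eq_self]
  simp

lemma Real.fourier_ofReal_neg (h : ℝ → ℝ) (v : ℝ) :
    𝓕 (fun x => (h x : ℂ)) (-v) = starRingEnd ℂ (𝓕 (fun x => (h x : ℂ)) v) := by
  rw [Real.fourier_real_eq_integral_exp_smul, Real.fourier_real_eq_integral_exp_smul,
    ← integral_conj]
  congr with x
  rw [smul_eq_mul, smul_eq_mul, map_mul, ← Complex.exp_conj]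
  simp [map_ofNat]

/-! ### The operator with kernel `j (x + y)` and its Fourier transform -/

namespace RankOneGraph

open scoped Convolution

/-- The operator `h ↦ ∫ j (x + y) h y dy` on real functions. -/
noncomputable def corr (j h : ℝ → ℝ) (x : ℝ) : ℝ := ∫ y, j (x + y) * h y

/-- A nonnegative, integrable, bounded and continuous function. -/
structure IsNiceKernel (h : ℝ → ℝ) : Prop where
  continuous : Continuous h
  nonneg : ∀ x, 0 ≤ h x
  integrable : Integrable h
  bounded : ∃ B, ∀ x, h x ≤ B

variable {j h : ℝ → ℝ}

/-- Reflecting `h` gives a convolution, from which continuity and integrability of `corr j h` are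
inherited. -/
lemma corr_eq_convolution (j h : ℝ → ℝ) :
    corr j h = j ⋆[ContinuousLinearMap.mul ℝ ℝ] fun x => h (-x) := by
  funext x
  rw [corr, convolution_def]
  refine Eq.trans ?_ (integral_add_right_eq_self
    (fun t => ContinuousLinearMap.mul ℝ ℝ (j t) (h (-(x - t)))) x)
  congr with y
  simp [add_comm]

lemma corr_ofReal_eq_convolution (j h : ℝ → ℝ) :
    (fun x => (corr j h x : ℂ)) = (fun x => (j x : ℂ)) ⋆[ContinuousLinearMap.mul ℂ ℂ]
      fun x => (h (-x) : ℂ) := by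
  funext x
  rw [corr, convolution_def, ← integral_complex_ofReal]
  refine Eq.trans ?_ (integral_add_right_eq_self
    (fun t => ContinuousLinearMap.mul ℂ ℂ (j t : ℂ) (h (-(x - t)) : ℂ)) x)
  congr with y
  simp [add_comm]

lemma IsNiceKernel.integrable_mul (hj : IsNiceKernel j) (hh : IsNiceKernel h) (x : ℝ) :
    Integrable fun y => j (x + y) * h y := by
  obtain ⟨B, hB⟩ := hj.bounded
  have := hj.continuous
  refine hh.integrable.bdd_mul (c := B) (by fun_prop) (ae_of_all _ fun y => ?_)
  rw [Real.norm_of_nonneg (hj.nonneg _)]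
  exact hB _

lemma IsNiceKernel.corr (hj : IsNiceKernel j) (hh : IsNiceKernel h) :
    IsNiceKernel (corr j h) where
  continuous := by
    obtain ⟨B, hB⟩ := hh.bounded
    rw [corr_eq_convolution]
    refine BddAbove.continuous_convolution_right_of_integrable _ ⟨B, ?_⟩ hj.integrable
      (hh.continuous.comp continuous_neg)
    rintro _ ⟨x, rfl⟩
    simp only [Real.norm_of_nonneg (hh.nonneg _)]
    exact hB _
  nonneg x := integral_nonneg fun y => mul_nonneg (hj.nonneg _) (hh.nonneg _)
  integrable := by
    rw [corr_eq_convolution]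
    exact hj.integrable.integrable_convolution _ hh.integrable.comp_neg
  bounded := by
    obtain ⟨B, hB⟩ := hj.bounded
    refine ⟨∫ y, B * h y, fun x => integral_mono (hj.integrable_mul hh x)
      (hh.integrable.const_mul B) fun y => ?_⟩
    exact mul_le_mul_of_nonneg_right (hB _) (hh.nonneg _)

lemma IsNiceKernel.hankel_eq (hj : IsNiceKernel j) (hh : IsNiceKernel h) :
    hankel (fun x => ENNReal.ofReal (j x)) (fun x => ENNReal.ofReal (h x)) =
      fun x => ENNReal.ofReal (RankOneGraph.corr j h x) := by
  funext x
  rw [RankOneGraph.corr, ofReal_integral_eq_lintegral_ofReal (hj.integrable_mul hh x)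
    (ae_of_all _ fun y => mul_nonneg (hj.nonneg _) (hh.nonneg _)), hankel]
  exact lintegral_congr fun y => (ENNReal.ofReal_mul (hj.nonneg _)).symm

lemma IsNiceKernel.fourier_corr (hj : IsNiceKernel j) (hh : IsNiceKernel h) (v : ℝ) :
    𝓕 (fun x => (RankOneGraph.corr j h x : ℂ)) v =
      𝓕 (fun x => (j x : ℂ)) v * 𝓕 (fun x => (h x : ℂ)) (-v) := by
  rw [corr_ofReal_eq_convolution, ← Real.fourier_comp_neg]
  exact Real.fourier_mul_convolution_eq (R := ℂ) hj.integrable.ofReal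
    hh.integrable.comp_neg.ofReal v

lemma IsNiceKernel.corr_iterate (hj : IsNiceKernel j) (m : ℕ) :
    IsNiceKernel ((RankOneGraph.corr j)^[m] j) := by
  induction m with
  | zero => exact hj
  | succ m ih => rw [Function.iterate_succ_apply']; exact hj.corr ih

lemma IsNiceKernel.hankel_iterate_eq (hj : IsNiceKernel j) (m : ℕ) :
    (hankel fun x => ENNReal.ofReal (j x))^[m] (fun x => ENNReal.ofReal (j x)) =
      fun x => ENNReal.ofReal ((RankOneGraph.corr j)^[m] j x) := by
  induction m with
  | zero => rfl
  | succ m ih =>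
    rw [Function.iterate_succ_apply', Function.iterate_succ_apply', ih,
      hj.hankel_eq (hj.corr_iterate m)]

/-- Each application evaluates the previous transform at `-v`, so two of them restore `v` and
contribute `J v * J (-v)`, which is `|J v|²` since `j` is real. -/
lemma IsNiceKernel.fourier_corr_iterate_odd (hj : IsNiceKernel j) (r : ℕ) (v : ℝ) :
    𝓕 (fun x => ((RankOneGraph.corr j)^[2 * r + 1] j x : ℂ)) v =
      ((‖𝓕 (fun x => (j x : ℂ)) v‖ ^ (2 * r + 2) : ℝ) : ℂ) := by
  induction r with
  | zero =>
    have := hj.fourier_corr hj v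
    rw [Real.fourier_ofReal_neg, Complex.mul_conj, Complex.normSq_eq_norm_sq] at this
    simpa using this
  | succ r ih =>
    have h1 := hj.fourier_corr (hj.corr (hj.corr_iterate (2 * r + 1))) v
    rw [hj.fourier_corr (hj.corr_iterate (2 * r + 1)) (-v), neg_neg, ih, Real.fourier_ofReal_neg,
      ← mul_assoc, Complex.mul_conj, Complex.normSq_eq_norm_sq] at h1
    rw [show 2 * (r + 1) + 1 = 2 * r + 1 + 1 + 1 by ring, Function.iterate_succ_apply',
      Function.iterate_succ_apply', h1]
    push_cast
    ring

theorem IsNiceKernel.integral_norm_fourier_pow (hj : IsNiceKernel j) {m : ℕ} (hm : Odd m) :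
    Integrable (fun v => ‖𝓕 (fun x => (j x : ℂ)) v‖ ^ (m + 1)) ∧
      ∫ v, ‖𝓕 (fun x => (j x : ℂ)) v‖ ^ (m + 1) = (RankOneGraph.corr j)^[m] j 0 := by
  obtain ⟨r, rfl⟩ := hm
  have hn := hj.corr_iterate (2 * r + 1)
  obtain ⟨h1, h2⟩ := Real.integral_fourier_of_nonneg hn.integrable.ofReal
    (Complex.continuous_ofReal.comp hn.continuous).continuousAt
    (fun v => by positivity) (hj.fourier_corr_iterate_odd r)
  exact ⟨h1, Complex.ofReal_injective h2⟩

/-- Keeps the limiting constant nonzero, so that it can be divided by. -/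
lemma IsNiceKernel.corr_iterate_pos (hj : IsNiceKernel j) (hpos : ∀ x, 0 < j x) (m : ℕ) (x : ℝ) :
    0 < (RankOneGraph.corr j)^[m] j x := by
  induction m generalizing x with
  | zero => exact hpos x
  | succ m ih =>
    rw [Function.iterate_succ_apply', RankOneGraph.corr, integral_pos_iff_support_of_nonneg
      (fun y => mul_nonneg (hj.nonneg _) ((hj.corr_iterate m).nonneg _))
      (hj.integrable_mul (hj.corr_iterate m) x)]
    have : (Function.support fun y => j (x + y) * (RankOneGraph.corr j)^[m] j y) = Set.univ :=
      Set.eq_univ_of_forall fun y => (mul_pos (hpos _) (ih y)).ne'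
    rw [this]
    simp

/-! ### Connection functions and decay of the kernel -/

namespace IsConnectionFunction

variable {f : ℝ → ℝ}

lemma le_one (hf : IsConnectionFunction f) {x : ℝ} (hx : 0 ≤ x) : f x ≤ 1 := by
  refine ge_of_tendsto hf.tendsto_atTop ?_
  filter_upwards [eventually_ge_atTop x] with y hy
  exact hf.monotoneOn hx (hx.trans hy) hy

lemma pos (hf : IsConnectionFunction f) {x : ℝ} (hx : 0 < x) : 0 < f x := by
  have h1 : ∀ᶠ y in 𝓝[>] (0 : ℝ), 0 < f y / y :=
    hf.tendsto_div_zero.eventually (lt_mem_nhds zero_lt_one)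
  have h2 : ∀ᶠ y in 𝓝[>] (0 : ℝ), y ∈ Set.Ioo 0 x := Ioo_mem_nhdsGT hx
  obtain ⟨y, hy, hy0, hyx⟩ := (h1.and h2).exists
  have : 0 < f y := by
    have := mul_pos hy hy0
    rwa [div_mul_cancel₀ _ hy0.ne'] at this
  exact this.trans_le (hf.monotoneOn hy0.le hx.le hyx.le)

lemma exists_le_mul (hf : IsConnectionFunction f) : ∃ C, 1 ≤ C ∧ ∀ x, 0 < x → f x ≤ C * x := by
  have h1 : ∀ᶠ y in 𝓝[>] (0 : ℝ), f y / y < 2 :=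
    hf.tendsto_div_zero.eventually (gt_mem_nhds one_lt_two)
  obtain ⟨δ, hδ, h⟩ := mem_nhdsGT_iff_exists_Ioo_subset.1 h1
  have hδ' : 0 < δ := hδ
  refine ⟨max 2 δ⁻¹, by simp, fun x hx => ?_⟩
  rcases lt_or_ge x δ with hxδ | hxδ
  · have : f x / x < 2 := h ⟨hx, hxδ⟩
    rw [div_lt_iff₀ hx] at this
    exact this.le.trans (mul_le_mul_of_nonneg_right (le_max_left _ _) hx.le)
  · refine (hf.le_one hx.le).trans ?_
    calc (1 : ℝ) = δ⁻¹ * δ := by rw [inv_mul_cancel₀ hδ'.ne']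
      _ ≤ max 2 δ⁻¹ * x := by
        gcongr
        exact le_max_right _ _

lemma continuous_max (hf : IsConnectionFunction f) : Continuous fun x => f (max x 0) :=
  hf.continuousOn.comp_continuous (by fun_prop) fun x => le_max_right x 0

end IsConnectionFunction

/-- The real-valued kernel `exp (-(τ - 1) u / 2) f (exp u)`. -/
noncomputable def jker (τ : ℝ) (f : ℝ → ℝ) (u : ℝ) : ℝ :=
  Real.exp (-(τ - 1) * u / 2) * f (Real.exp u)

section Kernel

variable {τ : ℝ} {f : ℝ → ℝ}

lemma jker_pos (hf : IsConnectionFunction f) (u : ℝ) : 0 < jker τ f u :=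
  mul_pos (Real.exp_pos _) (hf.pos (Real.exp_pos _))

lemma continuous_jker (hf : IsConnectionFunction f) : Continuous (jker τ f) :=
  Continuous.mul (by fun_prop)
    (hf.continuousOn.comp_continuous Real.continuous_exp fun x => (Real.exp_pos x).le)

/-- The kernel decays at rate `(τ - 1) / 2` at `+∞`, because `f ≤ 1`, and `(3 - τ) / 2` at `-∞`,
because `f x ≤ C * x`. The quadratic weight suffices for integrability and for `hKC`. -/
lemma exists_jker_le (hτ₂ : 2 < τ) (hτ₃ : τ < 3) (hf : IsConnectionFunction f) :
    ∃ B, ∀ u, (1 + u ^ 2) * jker τ f u ≤ B := by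
  obtain ⟨C, hC1, hC⟩ := hf.exists_le_mul
  -- The smaller of the two decay rates, as `τ > 2`.
  set b := (3 - τ) / 2 with hb
  have hb0 : 0 < b := by rw [hb]; linarith
  have hker : ∀ u, jker τ f u ≤ C * Real.exp (-(b * |u|)) := by
    intro u
    rcases le_total 0 u with hu | hu
    · rw [abs_of_nonneg hu]
      calc jker τ f u ≤ Real.exp (-(τ - 1) * u / 2) * 1 := by
            unfold jker
            gcongr
            exact hf.le_one (Real.exp_pos _).le
        _ ≤ Real.exp (-(b * u)) * C := by
            gcongr
            rw [hb]
            nlinarith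
        _ = _ := mul_comm _ _
    · rw [abs_of_nonpos hu]
      calc jker τ f u ≤ Real.exp (-(τ - 1) * u / 2) * (C * Real.exp u) := by
            unfold jker
            gcongr
            exact hC _ (Real.exp_pos _)
        _ = C * Real.exp (-(b * -u)) := by
            rw [mul_left_comm, ← Real.exp_add, hb]
            congr 2
            ring
  refine ⟨(1 + 2 / b ^ 2) * C, fun u => ?_⟩
  have h1 := Real.quadratic_le_exp_of_nonneg (x := b * |u|) (by positivity)
  have h2 : 1 + u ^ 2 ≤ (1 + 2 / b ^ 2) * Real.exp (b * |u|) := by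
    have h3 : u ^ 2 ≤ 2 / b ^ 2 * Real.exp (b * |u|) := by
      rw [div_mul_eq_mul_div, le_div_iff₀ (by positivity), ← sq_abs u]
      nlinarith [mul_nonneg hb0.le (abs_nonneg u)]
    have h4 : 1 ≤ Real.exp (b * |u|) := Real.one_le_exp (by positivity)
    linarith
  calc (1 + u ^ 2) * jker τ f u
      ≤ ((1 + 2 / b ^ 2) * Real.exp (b * |u|)) * (C * Real.exp (-(b * |u|))) :=
        mul_le_mul h2 (hker u) (jker_pos hf u).le (by positivity)
    _ = (1 + 2 / b ^ 2) * C * (Real.exp (b * |u|) * Real.exp (-(b * |u|))) := by ring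
    _ = _ := by rw [← Real.exp_add, add_neg_cancel, Real.exp_zero, mul_one]

lemma isNiceKernel_jker (hτ₂ : 2 < τ) (hτ₃ : τ < 3) (hf : IsConnectionFunction f) :
    IsNiceKernel (jker τ f) := by
  obtain ⟨B, hB⟩ := exists_jker_le hτ₂ hτ₃ hf
  refine ⟨continuous_jker hf, fun u => (jker_pos hf u).le, ?_, B, fun u => ?_⟩
  · refine (integrable_inv_one_add_sq.const_mul B).mono' (continuous_jker hf).aestronglyMeasurable
      (ae_of_all _ fun u => ?_)
    rw [Real.norm_of_nonneg (jker_pos hf u).le, ← div_eq_mul_inv, le_div_iff₀ (by positivity),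
      mul_comm]
    exact hB u
  · refine le_trans ?_ (hB u)
    nlinarith [jker_pos (τ := τ) hf u, mul_nonneg (sq_nonneg u) (jker_pos (τ := τ) hf u).le]

lemma jfun_eq : jfun τ f = fun u => (jker τ f u : ℂ) := rfl

lemma range_exp_eq : Real.exp '' Set.univ = Set.Ioi (0 : ℝ) := by
  rw [Set.image_univ, Real.range_exp]

/-- Under `x = exp u` the Jacobian raises the real exponent from `-(τ + 1) / 2` to `-(τ - 1) / 2`.
-/
lemma abs_exp_smul_integrandJ (v u : ℝ) :
    |Real.exp u| • integrandJ τ f v (Real.exp u) =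
      Complex.exp (((-2 * Real.pi * u * v : ℝ) : ℂ) * Complex.I) • jfun τ f u := by
  rw [Real.abs_exp, integrandJ, jfun, Complex.cpow_def_of_ne_zero (by simp),
    ← Complex.ofReal_log (Real.exp_pos u).le, Real.log_exp, Complex.real_smul, smul_eq_mul]
  push_cast
  rw [← mul_assoc, ← mul_assoc, ← Complex.exp_add, ← Complex.exp_add]
  congr 2
  ring

lemma integrableOn_integrandJ (hτ₂ : 2 < τ) (hτ₃ : τ < 3) (hf : IsConnectionFunction f) (v : ℝ) :
    IntegrableOn (integrandJ τ f v) (Set.Ioi 0) := by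
  rw [← range_exp_eq, integrableOn_image_iff_integrableOn_abs_deriv_smul MeasurableSet.univ
    (fun x _ => (Real.hasDerivAt_exp x).hasDerivWithinAt) Real.exp_injective.injOn,
    integrableOn_univ]
  simp_rw [abs_exp_smul_integrandJ]
  refine (isNiceKernel_jker hτ₂ hτ₃ hf).integrable.ofReal.bdd_mul (c := 1)
    (Continuous.aestronglyMeasurable (by fun_prop)) (ae_of_all _ fun u => ?_)
  rw [Complex.norm_exp_ofReal_mul_I]

lemma J_eq_fourier (v : ℝ) : J τ f v = 𝓕 (jfun τ f) v := by
  rw [J, ← range_exp_eq, integral_image_eq_integral_abs_deriv_smul MeasurableSet.univ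
    (fun x _ => (Real.hasDerivAt_exp x).hasDerivWithinAt) Real.exp_injective.injOn,
    setIntegral_univ, Real.fourier_real_eq_integral_exp_smul]
  simp_rw [abs_exp_smul_integrandJ]

lemma integral_norm_J_pow (hτ₂ : 2 < τ) (hτ₃ : τ < 3) (hf : IsConnectionFunction f) {m : ℕ}
    (hm : Odd m) : Integrable (fun v => ‖J τ f v‖ ^ (m + 1)) ∧
      ∫ v, ‖J τ f v‖ ^ (m + 1) = (corr (jker τ f))^[m] (jker τ f) 0 := by
  simp_rw [J_eq_fourier, jfun_eq]
  exact (isNiceKernel_jker hτ₂ hτ₃ hf).integral_norm_fourier_pow hm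

end Kernel

/-! ### Pareto weights in logarithmic coordinates -/

lemma lintegral_fin_prod (m : ℕ) {G : Fin m → ℝ → ℝ≥0∞}
    (hG : ∀ i, Measurable (G i)) :
    ∫⁻ u : Fin m → ℝ, ∏ i, G i (u i) = ∏ i, ∫⁻ x, G i x := by
  induction m with
  | zero => simp [lintegral_unique, volume_pi]
  | succ m ih =>
    rw [lintegral_fin_succ (by fun_prop), Fin.prod_univ_succ, ← ih fun i => hG i.succ,
      ← lintegral_mul_const _ (hG 0)]
    refine lintegral_congr fun x => ?_
    rw [← lintegral_const_mul _ (by fun_prop)]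
    refine lintegral_congr fun w => ?_
    rw [Fin.prod_univ_succ]
    simp

lemma pi_withDensity {ρ : ℝ → ℝ≥0∞} (hρ : Measurable ρ)
    [SigmaFinite (volume.withDensity ρ)] (m : ℕ) :
    Measure.pi (fun _ : Fin m => volume.withDensity ρ) =
      (volume : Measure (Fin m → ℝ)).withDensity fun u => ∏ i, ρ (u i) := by
  refine Measure.pi_eq fun s hs => ?_
  rw [withDensity_apply _ (MeasurableSet.univ_pi hs),
    ← lintegral_indicator (MeasurableSet.univ_pi hs)]
  have : ∀ u : Fin m → ℝ, (Set.univ.pi s).indicator (fun u => ∏ i, ρ (u i)) u =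
      ∏ i, (s i).indicator ρ (u i) := by
    intro u
    by_cases h : ∀ i, u i ∈ s i
    · rw [Set.indicator_of_mem (Set.mem_univ_pi.2 h)]
      exact Finset.prod_congr rfl fun i _ => (Set.indicator_of_mem (h i) _).symm
    · rw [Set.indicator_of_notMem (mt Set.mem_univ_pi.1 h)]
      push Not at h
      obtain ⟨i, hi⟩ := h
      exact (Finset.prod_eq_zero (Finset.mem_univ i) (Set.indicator_of_notMem hi _)).symm
  simp_rw [this]
  rw [lintegral_fin_prod m fun i => hρ.indicator (hs i)]
  refine Finset.prod_congr rfl fun i _ => ?_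
  rw [withDensity_apply _ (hs i), lintegral_indicator (hs i)]

/-- The density of `log (h / γ)` for a Pareto variable `h` of rate `r`. -/
noncomputable def logDensity (r γ : ℝ) (u : ℝ) : ℝ≥0∞ :=
  ENNReal.ofReal (r * γ ^ (-r)) * ((Set.Ici (-Real.log γ)).indicator 1 u *
    ENNReal.ofReal (Real.exp (-r * u)))

lemma measurable_logDensity (r γ : ℝ) : Measurable (logDensity r γ) := by
  unfold logDensity
  exact (((measurable_one.indicator measurableSet_Ici)).mul (by fun_prop)).const_mul _

lemma ofReal_mul_paretoPDF {r γ : ℝ} (hr : 0 < r) (hγ : 0 < γ) (u : ℝ) :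
    ENNReal.ofReal |γ * Real.exp u| * paretoPDF 1 r (γ * Real.exp u) = logDensity r γ u := by
  have hpos : 0 < γ * Real.exp u := mul_pos hγ (Real.exp_pos u)
  have hiff : -Real.log γ ≤ u ↔ 1 ≤ γ * Real.exp u := by
    rw [← Real.log_nonneg_iff hpos, Real.log_mul hγ.ne' (Real.exp_pos u).ne', Real.log_exp]
    constructor <;> intro h <;> linarith
  rw [logDensity, abs_of_pos hpos]
  by_cases h : -Real.log γ ≤ u
  · rw [Set.indicator_of_mem (Set.mem_Ici.2 h), paretoPDF_of_le (hiff.1 h), Pi.one_apply, one_mul,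
      ← ENNReal.ofReal_mul hpos.le, ← ENNReal.ofReal_mul (by positivity)]
    congr 1
    rw [Real.one_rpow, mul_one, neg_add, Real.rpow_add hpos, Real.rpow_neg_one,
      Real.mul_rpow hγ.le (Real.exp_pos u).le, ← Real.exp_mul, mul_comm u]
    field_simp
  · rw [Set.indicator_of_notMem (by simpa using h), paretoPDF_of_lt (not_le.1 (mt hiff.2 h))]
    simp

lemma measurePreserving_mul_exp {r γ : ℝ} (hr : 0 < r) (hγ : 0 < γ) :
    MeasurePreserving (fun u => γ * Real.exp u) (volume.withDensity (logDensity r γ))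
      (paretoMeasure 1 r) := by
  have hm : Measurable fun u : ℝ => γ * Real.exp u := by fun_prop
  refine ⟨hm, Measure.ext fun s hs => ?_⟩
  rw [Measure.map_apply hm hs, withDensity_apply _ (hm hs), paretoMeasure, withDensity_apply _ hs,
    ← lintegral_indicator (hm hs), ← lintegral_indicator hs]
  have himg : (fun u => γ * Real.exp u) '' Set.univ = Set.Ioi 0 := by
    ext x
    simp only [Set.image_univ, Set.mem_range, Set.mem_Ioi]
    constructor
    · rintro ⟨u, rfl⟩
      positivity
    · intro hx
      exact ⟨Real.log (x / γ), by rw [Real.exp_log (by positivity)]; field_simp⟩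
  -- The Pareto density vanishes below `1`, so only the range of `γ * exp u` matters.
  have hsupp : ∫⁻ x, s.indicator (paretoPDF 1 r) x =
      ∫⁻ x in Set.Ioi 0, s.indicator (paretoPDF 1 r) x := by
    rw [← lintegral_indicator measurableSet_Ioi]
    refine lintegral_congr fun x => ?_
    by_cases hx : 0 < x
    · rw [Set.indicator_of_mem (Set.mem_Ioi.2 hx)]
    · rw [Set.indicator_of_notMem (s := Set.Ioi 0) (mt Set.mem_Ioi.1 hx)]
      refine Set.indicator_apply_eq_zero.2 fun _ => paretoPDF_of_lt ?_
      linarith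
  rw [hsupp, ← himg, lintegral_image_eq_lintegral_abs_deriv_mul MeasurableSet.univ
    (fun x _ => ((Real.hasDerivAt_exp x).const_mul γ).hasDerivWithinAt)
    (fun x _ y _ h => Real.exp_injective (mul_left_cancel₀ hγ.ne' h)), setLIntegral_univ]
  refine lintegral_congr fun u => ?_
  by_cases hu : γ * Real.exp u ∈ s
  · rw [Set.indicator_of_mem (show u ∈ (fun u => γ * Real.exp u) ⁻¹' s from hu), Set.indicator_of_mem hu,
      ofReal_mul_paretoPDF hr hγ]
  · rw [Set.indicator_of_notMem (show u ∉ (fun u => γ * Real.exp u) ⁻¹' s from hu), Set.indicator_of_notMem hu, mul_zero]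

/-- Each vertex lies on two edges, whose half exponents combine into its full density factor. -/
lemma cycleWeight_jker {τ : ℝ} {f g : ℝ → ℝ} (hfg : ∀ x, 0 ≤ x → f x = g x) {m : ℕ}
    (u : Fin (m + 1) → ℝ) :
    cycleWeight (fun x => ENNReal.ofReal (jker τ f x)) u =
      (∏ i, ENNReal.ofReal (Real.exp (-(τ - 1) * u i))) *
        ∏ i, ENNReal.ofReal (g (Real.exp (u i + u (i + 1)))) := by
  have h1 : ∏ i, ENNReal.ofReal (Real.exp (-(τ - 1) * u (i + 1) / 2)) =
      ∏ i, ENNReal.ofReal (Real.exp (-(τ - 1) * u i / 2)) :=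
    Equiv.prod_comp (Equiv.addRight 1) fun i => ENNReal.ofReal (Real.exp (-(τ - 1) * u i / 2))
  have h2 : ∏ i, ENNReal.ofReal (Real.exp (-(τ - 1) * u i)) =
      (∏ i, ENNReal.ofReal (Real.exp (-(τ - 1) * u i / 2))) *
        ∏ i, ENNReal.ofReal (Real.exp (-(τ - 1) * u (i + 1) / 2)) := by
    rw [h1, ← Finset.prod_mul_distrib]
    refine Finset.prod_congr rfl fun i _ => ?_
    rw [← ENNReal.ofReal_mul (Real.exp_nonneg _), ← Real.exp_add, add_halves]
  rw [h2, ← Finset.prod_mul_distrib, ← Finset.prod_mul_distrib, cycleWeight]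
  refine Finset.prod_congr rfl fun i _ => ?_
  rw [jker, ENNReal.ofReal_mul (Real.exp_nonneg _), ← ENNReal.ofReal_mul (Real.exp_nonneg (-(τ - 1) * u i / 2)),
    ← Real.exp_add, hfg _ (Real.exp_nonneg _)]
  congr 3
  ring

lemma prod_logDensity (r γ : ℝ) {m : ℕ} (u : Fin m → ℝ) :
    ∏ i, logDensity r γ (u i) = ENNReal.ofReal (r * γ ^ (-r)) ^ m *
      ({u : Fin m → ℝ | ∀ i, -Real.log γ ≤ u i}.indicator 1 u *
        ∏ i, ENNReal.ofReal (Real.exp (-r * u i))) := by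
  simp only [logDensity]
  rw [Finset.prod_mul_distrib, Finset.prod_const, Finset.card_univ, Fintype.card_fin,
    Finset.prod_mul_distrib]
  congr 2
  by_cases h : ∀ i, -Real.log γ ≤ u i
  · rw [Set.indicator_of_mem (show u ∈ {u : Fin m → ℝ | ∀ i, -Real.log γ ≤ u i} from h)]
    exact Finset.prod_eq_one fun i _ => Set.indicator_of_mem (Set.mem_Ici.2 (h i)) _
  · rw [Set.indicator_of_notMem (show u ∉ {u : Fin m → ℝ | ∀ i, -Real.log γ ≤ u i} from h)]
    push Not at h
    obtain ⟨i, hi⟩ := h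
    exact Finset.prod_eq_zero (Finset.mem_univ i) (Set.indicator_of_notMem (by simpa using hi) _)

/-- After `h_i = γ exp u_i` the scale leaves the edge probabilities and survives only in the
prefactor and the cutoff `-log γ`. -/
lemma cycleProb_eq {τ γ : ℝ} (hτ : 1 < τ) (hγ : 0 < γ) {f g : ℝ → ℝ} (hg : Measurable g)
    (hfg : ∀ x, 0 ≤ x → f x = g x) (m : ℕ) :
    cycleProb τ g m (γ ^ 2) = ENNReal.ofReal ((τ - 1) * γ ^ (1 - τ)) ^ (m + 1) *
      cycleIntegral (fun x => ENNReal.ofReal (jker τ f x)) m (Real.log γ) := by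
  have hr : 0 < τ - 1 := sub_pos.2 hτ
  have := isProbabilityMeasure_paretoMeasure one_pos hr
  have hmp := measurePreserving_mul_exp hr hγ
  have : IsProbabilityMeasure (volume.withDensity (logDensity (τ - 1) γ)) := by
    constructor
    rw [← hmp.measure_preimage MeasurableSet.univ.nullMeasurableSet |>.trans measure_univ,
      Set.preimage_univ]
  have hpi := measurePreserving_pi (fun _ : Fin (m + 1) => volume.withDensity (logDensity (τ - 1) γ))
    (fun _ => paretoMeasure 1 (τ - 1)) (fun _ => hmp)
  have hρ := measurable_logDensity (τ - 1) γ
  rw [cycleProb, ← hpi.lintegral_comp (by fun_prop), pi_withDensity hρ,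
    lintegral_withDensity_eq_lintegral_mul _ (by fun_prop) (by fun_prop), cycleIntegral,
    ← lintegral_const_mul']
  · refine lintegral_congr fun u => ?_
    rw [Pi.mul_apply, prod_logDensity, cycleWeight_jker hfg, neg_sub]
    have : ∀ i, γ * Real.exp (u i) * (γ * Real.exp (u (i + 1))) / γ ^ 2 =
        Real.exp (u i + u (i + 1)) := by
      intro i
      rw [Real.exp_add]
      field_simp
    simp only [this]
    ring
  · exact ENNReal.pow_ne_top ENNReal.ofReal_ne_top

/-! ### The asymptotics of the cycle count -/

lemma tendsto_gam {τ : ℝ} (hτ : 2 < τ) : Tendsto (gam τ) atTop atTop := by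
  refine Real.tendsto_sqrt_atTop.comp (tendsto_natCast_atTop_atTop.atTop_mul_const ?_)
  exact div_pos (by linarith) (by linarith)

end RankOneGraph

open RankOneGraph in
theorem theorem3p8 (τ : ℝ) (hτ₂ : 2 < τ) (hτ₃ : τ < 3) (f : ℝ → ℝ)
    (hf : RankOneGraph.IsConnectionFunction f) (k : ℕ) (hk : 4 ≤ k) (hkeven : Even k) :
    (∀ n : ℕ, Integrable (RankOneGraph.cycleCount τ f k n) (RankOneGraph.sampleLaw τ n)) ∧
    (∀ v : ℝ, IntegrableOn (RankOneGraph.integrandJ τ f v) (Set.Ioi 0)) ∧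
    (∀ v : ℝ, RankOneGraph.J τ f v = 𝓕 (RankOneGraph.jfun τ f) v) ∧
    Integrable (fun v : ℝ => ‖RankOneGraph.J τ f v‖ ^ k) ∧
    Tendsto (fun n : ℕ => RankOneGraph.avgCycles τ f k n /
      (RankOneGraph.gam τ n ^ ((k : ℝ) * (1 - τ)) * Real.log (RankOneGraph.gam τ n) *
        (τ - 1) ^ k * (1 / (k : ℝ)) * (n.choose k : ℝ) * (k.factorial : ℝ) *
        ∫ v : ℝ, ‖RankOneGraph.J τ f v‖ ^ k)) atTop (𝓝 1) := by
  obtain ⟨m, rfl⟩ : ∃ m, k = m + 3 := ⟨k - 3, by omega⟩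
  have hodd : Odd (m + 2) := by
    obtain ⟨r, hr⟩ := hkeven
    exact ⟨r - 1, by omega⟩
  have hτ : 1 < τ := by linarith
  set g : ℝ → ℝ := fun x => f (max x 0) with hg
  have hfg : ∀ x, 0 ≤ x → f x = g x := fun x hx => by simp [hg, hx]
  have hgm : Measurable g := hf.continuous_max.measurable
  have hg0 : ∀ x, 0 ≤ g x := fun x => hf.nonneg _ (le_max_right _ _)
  have hg1 : ∀ x, g x ≤ 1 := fun x => hf.le_one (le_max_right _ _)
  have hnice := isNiceKernel_jker hτ₂ hτ₃ hf
  obtain ⟨hJint, hJeq⟩ := integral_norm_J_pow hτ₂ hτ₃ hf hodd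
  refine ⟨fun n => (integrable_cycleCount_of_measurable hτ hgm m n).congr
      (cycleCount_congr_ae hτ hfg _ n).symm, integrableOn_integrandJ hτ₂ hτ₃ hf,
    J_eq_fourier, hJint, ?_⟩
  rw [show m + 3 = m + 2 + 1 from rfl, hJeq]
  set S := (corr (jker τ f))^[m + 2] (jker τ f) 0 with hS
  have hSpos : 0 < S := hnice.corr_iterate_pos (jker_pos hf) _ _
  obtain ⟨B, hB⟩ := exists_jker_le hτ₂ hτ₃ hf
  have hlim := tendsto_cycleIntegral_div (K := fun x => ENNReal.ofReal (jker τ f x))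
    (hnice.continuous.measurable.ennreal_ofReal) hodd (C := ENNReal.ofReal (2 * B))
    ENNReal.ofReal_ne_top (fun x => by
      rw [← ENNReal.ofReal_mul (by positivity)]
      refine ENNReal.ofReal_le_ofReal ?_
      -- Passes from the quadratic weight to the linear one; hence the constant `2 * B`.
      have h1 : 1 + |x| ≤ 2 * (1 + x ^ 2) := by
        rw [← sq_abs]
        nlinarith [sq_nonneg (|x| - 1)]
      nlinarith [hB x, mul_le_mul_of_nonneg_right h1 (jker_pos (τ := τ) hf x).le])
    hnice.integrable.lintegral_lt_top.ne
  rw [hnice.hankel_iterate_eq] at hlim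
  change Tendsto _ _ (𝓝 (ENNReal.ofReal S)) at hlim
  have hlog : Tendsto (fun n => Real.log (gam τ n)) atTop atTop :=
    Real.tendsto_log_atTop.comp (tendsto_gam hτ₂)
  have hlim2 := ((ENNReal.tendsto_toReal ENNReal.ofReal_ne_top).comp (hlim.comp hlog)).div_const S
  rw [ENNReal.toReal_ofReal hSpos.le, div_self hSpos.ne'] at hlim2
  refine hlim2.congr' ?_
  -- These bounds make the logarithm and the binomial coefficient positive. The two quotients then
  -- agree exactly, the `2` of `2 * L` cancelling that of `2 * (m + 3)`.
  filter_upwards [(tendsto_gam hτ₂).eventually_gt_atTop 1, eventually_ge_atTop (m + 3)] with n hγ hn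
  have hγ0 : 0 < gam τ n := by linarith
  have hL : 0 < Real.log (gam τ n) := Real.log_pos hγ
  have hchoose : (0 : ℝ) < n.choose (m + 3) := Nat.cast_pos.2 (Nat.choose_pos hn)
  have hfact : (0 : ℝ) < (m + 3).factorial := Nat.cast_pos.2 (Nat.factorial_pos _)
  have havg : avgCycles τ f (m + 3) n = avgCycles τ g (m + 3) n :=
    integral_congr_ae (cycleCount_congr_ae hτ hfg _ n)
  have hpow : gam τ n ^ (((m + 2 + 1 : ℕ) : ℝ) * (1 - τ)) = (gam τ n ^ (1 - τ)) ^ (m + 3) := by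
    rw [mul_comm, Real.rpow_mul hγ0.le, Real.rpow_natCast]
  rw [havg, avgCycles_of_measurable hτ hgm hg0 hg1, cycleProb_eq hτ hγ0 hgm hfg, hpow]
  simp only [Function.comp_apply, ENNReal.toReal_div, ENNReal.toReal_mul, ENNReal.toReal_pow]
  rw [ENNReal.toReal_ofReal (by positivity), ENNReal.toReal_ofReal
    (mul_nonneg (by linarith) (Real.rpow_nonneg hγ0.le _)), mul_pow]
  have h1 : 0 < (gam τ n ^ (1 - τ)) ^ (m + 3) := pow_pos (Real.rpow_pos_of_pos hγ0 _) _
  have h2 : 0 < (τ - 1) ^ (m + 3) := pow_pos (by linarith) _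
  rw [show m + 2 + 1 = m + 3 from rfl]
  push_cast
  field_simp
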